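/- Let $n\ge 0$ be an integer and $k\in\mathbb{Z}$ with $|k|\le n$. Let $J\subseteq\mathbb{R}$ be an open interval containing $0$, and for each $t\in J$ let $(c_j)_{j\in\mathbb{Z}}=(c_j(t))_{j\in\mathbb{Z}}$ be a sequence of real numbers with $c_{-j}=c_j$, such that $c_j$ does not depend on $t$ for $j\ne\pm k$, while $c_k=c_k(t)$ is a continuously differentiable function of $t\in J$. Assume that for every $t\in J$ and every $m\ge 1$ the Toeplitz matrix $C_m=(c_{l-j})_{j,l=1}^m$ is positive definite. Let $Q_0,Q_1,\dots$ be the monic orthogonal polynomials on the unit circle with moments $(c_j)$, that is, $Q_0=1$ and $Q_m(z)=\det M_m(z)/\det C_m$, where the $(m+1)\times(m+1)$ matrix $M_m(z)$ has the rows $(c_i,c_{i-1},\dots,c_{i-m})$, $0\le i\le m-1$, followed by the row $(1,z,\dots,z^m)$. Let $q_m=Q_m/\|Q_m\|$, where $\|\sum_l a_lz^l\|^2=\sum_{i,l}\overline{a_i}\,a_l\,c_{i-l}$, let $K_n(w,z)=\sum_{j=0}^n\overline{q_j(w)}\,q_j(z)$ be the Christoffel–Darboux kernel, and let $$P_{n+1}(z;t)=zQ_n(z)+Q_n^*(z),\qquad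 Q_n^*(z)=z^n\,\overline{Q_n(1/\overline z)},$$ be the monic paraorthogonal polynomial $zQ_n-\overline{b}\,Q_n^*$ with parameter $b=-1$. Assume that for every $t\in J$ the polynomial $z\mapsto K_n(-1,z)$ is a Hurwitz polynomial, i.e. all its zeros lie in the open left half-plane, and that $c_k(t)$ is a strictly increasing function of $t\in J$. Let $\zeta_0$ be a zero of $P_{n+1}(\cdot;0)$. Then there exist $\epsilon>0$ with $(-\epsilon,\epsilon)\subseteq J$, $\delta>0$, and a unique function $\zeta:(-\epsilon,\epsilon)\to\{z:|z|=1,\ |z-\zeta_0|<\delta\}$, differentiable, with $\zeta(0)=\zeta_0$ and $P_{n+1}(\zeta(t);t)=0$ for all $t\in(-\epsilon,\epsilon)$. Moreover, for any $\epsilon,\delta>0$ with $(-\epsilon,\epsilon)\subseteq J$ and any such function $\zeta$, as $t$ increases on $(-\epsilon,\epsilon)$ the point $\zeta(t)$ moves along the left half-circle $\mathbb{S}^1_-=\{z:|z|=1,\ \Re z<0\}$, clockwise if $\Im\zeta_0>0$ and counterclockwise if $\Im\zeta_0<0$; that is, $\zeta(t)\in\mathbb{S}^1_-$ and $\zeta(t)=e^{i\varphi(t)}$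 for a continuous real function $\varphi$ on $(-\epsilon,\epsilon)$ that is strictly decreasing, respectively strictly increasing. -/

import Mathlib

open Polynomial
open scoped ComplexOrder

noncomputable section

/-- The `m`-by-`m` Toeplitz matrix `C_m = (c_{l-j})_{j,l}`. -/
def toeplitz (c : ℤ → ℂ) (m : ℕ) : Matrix (Fin m) (Fin m) ℂ :=
  Matrix.of fun j l => c ((l : ℤ) - (j : ℤ))

/-- The matrix whose first `n` rows are `(c_i, c_{i-1}, …, c_{i-n})`, `i = 0, …, n-1`, and whose
last row is `(1, X, …, X^n)`. -/
def opucMatrix (c : ℤ → ℂ) (n : ℕ) : Matrix (Fin (n + 1)) (Fin (n + 1)) ℂ[X] :=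
  Matrix.of fun i l =>
    if (i : ℕ) < n then C (c ((i : ℤ) - (l : ℤ))) else X ^ (l : ℕ)

/-- The monic orthogonal polynomial on the unit circle `Q_n` (for `n = 0` this is `1`). -/
def opuc (c : ℤ → ℂ) (n : ℕ) : ℂ[X] :=
  C (1 / (toeplitz c n).det) * (opucMatrix c n).det

/-- The inner product `∫ q(z) conj(p(z)) dσ` of polynomials, written through the moments
`c_j = ∫ z^{-j} dσ` of the orthogonality measure `σ`. -/
def momentInner (c : ℤ → ℂ) (p q : ℂ[X]) : ℂ :=
  p.sum fun i a => q.sum fun l b => (starRingEnd ℂ) a * b * c ((i : ℤ) - (l : ℤ))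

/-- The norm `‖p‖` in `L²(σ)`. -/
def momentNorm (c : ℤ → ℂ) (p : ℂ[X]) : ℝ :=
  Real.sqrt (momentInner c p p).re

/-- The normalized orthogonal polynomial `q_n = Q_n / ‖Q_n‖`. -/
def opucNormalized (c : ℤ → ℂ) (n : ℕ) : ℂ[X] :=
  C (((momentNorm c (opuc c n))⁻¹ : ℝ) : ℂ) * opuc c n

/-- The Christoffel–Darboux kernel `K_n(w, ·) = ∑_{j=0}^n conj(q_j(w)) q_j`, as a polynomial in its
second argument. -/
def cdKernel (c : ℤ → ℂ) (n : ℕ) (w : ℂ) : ℂ[X] :=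
  ∑ j ∈ Finset.range (n + 1),
    C ((starRingEnd ℂ) ((opucNormalized c j).eval w)) * opucNormalized c j

/-- The reversed polynomial `Q_n^*(z) = z^n conj(Q_n(1 / conj z))`. -/
def opucStar (c : ℤ → ℂ) (n : ℕ) : ℂ[X] :=
  ((opuc c n).map (starRingEnd ℂ)).reflect n

/-- The monic paraorthogonal polynomial `P_{n+1}(z, b) = z Q_n(z) - conj(b) Q_n^*(z)`, of degree
`n + 1`. -/
def popuc (c : ℤ → ℂ) (n : ℕ) (b : ℂ) : ℂ[X] :=
  X * opuc c n - C ((starRingEnd ℂ) b) * opucStar c n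

/-- A Hurwitz polynomial: all its zeros lie in the open left half-plane. -/
def IsHurwitz (p : ℂ[X]) : Prop :=
  ∀ z : ℂ, p.IsRoot z → z.re < 0

/-- The open left half `{z : |z| = 1, Re z < 0}` of the unit circle. -/
def leftHalfCircle : Set ℂ :=
  {z | z ∈ Metric.sphere (0 : ℂ) 1 ∧ z.re < 0}

/-- `ζ` is a differentiable function from `(-ε, ε)` to the arc `{z : |z| = 1, |z - ζ₀| < δ}` with
`ζ(0) = ζ₀` such that `ζ(t)` is a zero of `P(t)` for every `t ∈ (-ε, ε)`. -/
structure IsZeroBranch (P : ℝ → ℂ[X]) (ζ₀ : ℂ) (ε δ : ℝ) (ζ : ℝ → ℂ) : Prop where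
  mapsTo : Set.MapsTo ζ (Set.Ioo (-ε) ε) (Metric.ball ζ₀ δ ∩ Metric.sphere (0 : ℂ) 1)
  differentiableOn : DifferentiableOn ℝ ζ (Set.Ioo (-ε) ε)
  map_zero : ζ 0 = ζ₀
  isRoot : ∀ t ∈ Set.Ioo (-ε) ε, (P t).IsRoot (ζ t)

/-- As `t` increases on `I`, the point `ζ(t)` moves clockwise along the arc `A` of the unit circle:
it stays in `A` and has a continuous argument that is strictly decreasing. -/
def MovesClockwiseAlong (A : Set ℂ) (I : Set ℝ) (ζ : ℝ → ℂ) : Prop :=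
  Set.MapsTo ζ I A ∧ ∃ φ : ℝ → ℝ, ContinuousOn φ I ∧
    (∀ t ∈ I, ζ t = Complex.exp (φ t * Complex.I)) ∧ StrictAntiOn φ I

/-- As `t` increases on `I`, the point `ζ(t)` moves counterclockwise along the arc `A` of the unit
circle: it stays in `A` and has a continuous argument that is strictly increasing. -/
def MovesCounterclockwiseAlong (A : Set ℂ) (I : Set ℝ) (ζ : ℝ → ℂ) : Prop :=
  Set.MapsTo ζ I A ∧ ∃ φ : ℝ → ℝ, ContinuousOn φ I ∧
    (∀ t ∈ I, ζ t = Complex.exp (φ t * Complex.I)) ∧ StrictMonoOn φ I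

end

/-! The moments are real, so everything can be done with real polynomials and the bilinear form
⟨X^i, X^l⟩ = c_{i-l}, which is symmetric, positive definite and invariant under multiplying both
arguments by X. Since P = X Q_n + Q_n^* is orthogonal to X, …, X^n, it has no factor (X - α)(X -
1/conj α) (`popuc_not_mul_dvd`). Hence its zeros are simple and lie on the unit circle, and the
implicit function theorem gives the local branch.

The Hurwitz hypothesis forces n to be even, and then P is a constant times (X + 1) K_n(-1, ·) by
Christoffel–Darboux. So P is itself Hurwitz, -1 is a zero for every t, and all coefficients of P,
and of P divided by a pair of conjugate zeros, are positive (`hasPosCoeffs_of_isHurwitz`).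

The direction of motion comes from a finite-difference identity, not from differentiating. Let x, y
be the real parts of the branch at s, t, and write P_s = (X² - 2xX + 1) p and P_t = (X² - 2yX + 1)
q. Orthogonality gives 2(x - y)⟨q, p⟩_s = ⟨X p, P_t⟩ taken with the moments c(s) - c(t)
(`two_mul_sub_mul_momentForm`). These live only at ±k, so the right side is c_k(s) - c_k(t) times a
positive sum of products of coefficients. Thus the real part is injective in t, hence strictly
monotone. Near s = t = 0 the factor ⟨q, p⟩ is positive, so the real part increases. On the unit
circle this means clockwise motion above the real axis and counterclockwise below it. -/

/-- The bilinear extension of `(X ^ i, X ^ l) ↦ c (i - l)` to polynomials. -/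
noncomputable def momentForm {A : Type*} [CommRing A] (c : ℤ → A) : A[X] →ₗ[A] A[X] →ₗ[A] A :=
  Polynomial.lsum fun i => LinearMap.toSpanSingleton A (A[X] →ₗ[A] A)
    (Polynomial.lsum fun l => LinearMap.toSpanSingleton A A (c ((i : ℤ) - (l : ℤ))))

/-! ### The bilinear form of a moment sequence -/

section momentForm

variable {A : Type*} [CommRing A]

theorem momentForm_apply (c : ℤ → A) (p q : A[X]) :
    momentForm c p q = p.sum fun i a => q.sum fun l b => a * b * c ((i : ℤ) - (l : ℤ)) := by
  simp only [momentForm, Polynomial.lsum_apply, LinearMap.toSpanSingleton_apply, Polynomial.sum_def,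
    LinearMap.sum_apply, LinearMap.smul_apply, smul_eq_mul, Finset.mul_sum, mul_assoc]

theorem momentForm_monomial (c : ℤ → A) (i l : ℕ) (a b : A) :
    momentForm c (monomial i a) (monomial l b) = a * b * c ((i : ℤ) - (l : ℤ)) := by
  rw [momentForm_apply, sum_monomial_index, sum_monomial_index] <;> simp

theorem momentForm_X_pow (c : ℤ → A) (i l : ℕ) :
    momentForm c (X ^ i) (X ^ l) = c ((i : ℤ) - (l : ℤ)) := by
  rw [X_pow_eq_monomial, X_pow_eq_monomial, momentForm_monomial]; simp

theorem momentForm_eq_sum (c : ℤ → A) {p q : A[X]} {N M : ℕ} (hp : p.natDegree < N)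
    (hq : q.natDegree < M) :
    momentForm c p q = ∑ i ∈ Finset.range N, ∑ l ∈ Finset.range M,
      p.coeff i * q.coeff l * c ((i : ℤ) - (l : ℤ)) := by
  rw [momentForm_apply, sum_over_range' _ (by simp [Polynomial.sum_def]) _ hp]
  refine Finset.sum_congr rfl fun i _ => ?_
  rw [sum_over_range' _ (by simp) _ hq]

theorem momentForm_C_mul_left (c : ℤ → A) (a : A) (p q : A[X]) :
    momentForm c (C a * p) q = a * momentForm c p q := by
  rw [← smul_eq_C_mul, map_smul, LinearMap.smul_apply, smul_eq_mul]

theorem momentForm_C_mul_right (c : ℤ → A) (a : A) (p q : A[X]) :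
    momentForm c p (C a * q) = a * momentForm c p q := by
  rw [← smul_eq_C_mul, map_smul, smul_eq_mul]

/-- The Toeplitz structure: moments depend only on the difference of exponents. -/
theorem momentForm_X_mul_X_mul (c : ℤ → A) (p q : A[X]) :
    momentForm c (X * p) (X * q) = momentForm c p q := by
  induction p using Polynomial.induction_on' with
  | add p₁ p₂ h₁ h₂ => simp only [mul_add, map_add, LinearMap.add_apply, h₁, h₂]
  | monomial i a =>
    induction q using Polynomial.induction_on' with
    | add q₁ q₂ h₁ h₂ => simp only [mul_add, map_add, h₁, h₂]
    | monomial l b =>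
      simp only [X_mul_monomial, momentForm_monomial]
      push_cast
      rw [add_sub_add_right_eq_sub]

theorem momentForm_comm {c : ℤ → A} (hc : ∀ j, c (-j) = c j) (p q : A[X]) :
    momentForm c p q = momentForm c q p := by
  induction p using Polynomial.induction_on' with
  | add p₁ p₂ h₁ h₂ => simp only [map_add, LinearMap.add_apply, h₁, h₂]
  | monomial i a =>
    induction q using Polynomial.induction_on' with
    | add q₁ q₂ h₁ h₂ => simp only [map_add, LinearMap.add_apply, h₁, h₂]
    | monomial l b =>
      simp only [momentForm_monomial]
      rw [← hc ((i : ℤ) - l), neg_sub, mul_comm a b]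

theorem momentForm_sub_weight (c d : ℤ → A) (p q : A[X]) :
    momentForm (fun j => c j - d j) p q = momentForm c p q - momentForm d p q := by
  rw [momentForm_eq_sum _ (Nat.lt_succ_self _) (Nat.lt_succ_self _),
    momentForm_eq_sum _ (Nat.lt_succ_self _) (Nat.lt_succ_self _),
    momentForm_eq_sum _ (Nat.lt_succ_self _) (Nat.lt_succ_self _)]
  simp only [← Finset.sum_sub_distrib, mul_sub]

theorem momentForm_map {B : Type*} [CommRing B] (f : A →+* B) (c : ℤ → A) (p q : A[X]) :
    momentForm (fun j => f (c j)) (p.map f) (q.map f) = f (momentForm c p q) := by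
  induction p using Polynomial.induction_on' with
  | add p₁ p₂ h₁ h₂ => simp only [Polynomial.map_add, map_add, LinearMap.add_apply, h₁, h₂]
  | monomial i a =>
    induction q using Polynomial.induction_on' with
    | add q₁ q₂ h₁ h₂ => simp only [Polynomial.map_add, map_add, h₁, h₂]
    | monomial l b => simp [momentForm_monomial]

end momentForm

/-! ### Link with the Hermitian inner product, and positivity -/

theorem momentInner_eq_momentForm (c : ℤ → ℂ) (p q : ℂ[X]) :
    momentInner c p q = momentForm c (p.map (starRingEnd ℂ)) q := by
  rw [momentForm_eq_sum c (N := p.natDegree + 1) (by simp)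
    (Nat.lt_succ_self _), momentInner, sum_over_range _ (by simp [Polynomial.sum_def])]
  refine Finset.sum_congr rfl fun i _ => ?_
  rw [sum_over_range _ (by simp)]
  simp [coeff_map]

theorem momentForm_conj_self_pos {c : ℤ → ℂ} (hc : ∀ j, c (-j) = c j)
    (hpos : ∀ m, (toeplitz c m).PosDef) {p : ℂ[X]} (hp : p ≠ 0) :
    0 < momentForm c (p.map (starRingEnd ℂ)) p := by
  have hx : (fun i : Fin (p.natDegree + 1) => p.coeff i) ≠ 0 := by
    intro h
    have := congrFun h (Fin.last _)
    simp at this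
    exact hp this
  have h := (hpos (p.natDegree + 1)).dotProduct_mulVec_pos hx
  rw [momentForm_eq_sum c (N := p.natDegree + 1) (by simp) (Nat.lt_succ_self _),
    Finset.sum_range]
  convert h using 1
  simp only [dotProduct, Matrix.mulVec, Finset.mul_sum, toeplitz, Matrix.of_apply, Pi.star_apply,
    coeff_map, Finset.sum_range]
  refine Finset.sum_congr rfl fun i _ => Finset.sum_congr rfl fun l _ => ?_
  rw [← hc, neg_sub, starRingEnd_apply]
  ring

theorem momentForm_self_pos {c : ℤ → ℝ} (hc : ∀ j, c (-j) = c j)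
    (hpos : ∀ m, (toeplitz (fun j => (c j : ℂ)) m).PosDef) {p : ℝ[X]} (hp : p ≠ 0) :
    0 < momentForm c p p := by
  have h := momentForm_conj_self_pos (c := fun j => (c j : ℂ)) (fun j => by rw [hc]) hpos
    (p := p.map Complex.ofRealHom) ((Polynomial.map_ne_zero_iff Complex.ofRealHom.injective).2 hp)
  have e : (p.map Complex.ofRealHom).map (starRingEnd ℂ) = p.map Complex.ofRealHom := by
    ext i; simp
  rw [e] at h
  have h2 := momentForm_map Complex.ofRealHom c p p
  simp only [Complex.ofRealHom_eq_coe] at h2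
  rw [h2] at h
  exact_mod_cast h

/-! ### Orthogonal polynomials with real coefficients -/

/-- The cofactor of the entry `X ^ l` in the determinant defining the orthogonal polynomial. -/
noncomputable def opucCofactor (c : ℤ → ℝ) (n : ℕ) (l : Fin (n + 1)) : ℝ :=
  (-1) ^ (n + (l : ℕ)) *
    (Matrix.of fun i m : Fin n => c ((i : ℤ) - ((l.succAbove m : Fin (n + 1)) : ℕ))).det

/-- The real Toeplitz determinant of size `n`. -/
noncomputable def realToeplitzDet (c : ℤ → ℝ) (n : ℕ) : ℝ :=
  (Matrix.of fun j l : Fin n => c ((l : ℤ) - (j : ℤ))).det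

/-- The monic orthogonal polynomial of a real sequence of moments, as a real polynomial. -/
noncomputable def realOpuc (c : ℤ → ℝ) (n : ℕ) : ℝ[X] :=
  ∑ l : Fin (n + 1), C (opucCofactor c n l / realToeplitzDet c n) * X ^ (l : ℕ)

theorem toeplitz_det_ofReal (c : ℤ → ℝ) (n : ℕ) :
    (toeplitz (fun j => (c j : ℂ)) n).det = realToeplitzDet c n := by
  rw [realToeplitzDet, ← Complex.ofRealHom_eq_coe, RingHom.map_det]
  rfl

/-- Laplace expansion along the last row, the only row that contains X. -/
theorem opuc_ofReal (c : ℤ → ℝ) (n : ℕ) :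
    opuc (fun j => (c j : ℂ)) n = (realOpuc c n).map Complex.ofRealHom := by
  rw [opuc, realOpuc, toeplitz_det_ofReal, Matrix.det_succ_row _ (Fin.last n), Finset.mul_sum,
    Polynomial.map_sum]
  refine Finset.sum_congr rfl fun l _ => ?_
  have h : ((opucMatrix (fun j => (c j : ℂ)) n).submatrix (Fin.last n).succAbove l.succAbove) =
      (C.comp Complex.ofRealHom).mapMatrix
        (Matrix.of fun i m : Fin n => c ((i : ℤ) - ((l.succAbove m : Fin (n + 1)) : ℕ))) := by
    ext1 i m
    simp [opucMatrix]
  rw [h, ← RingHom.map_det]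
  simp only [opucMatrix, Matrix.of_apply, Fin.val_last, lt_irrefl, if_false, opucCofactor,
    RingHom.comp_apply, Polynomial.map_mul, map_C, Polynomial.map_pow, map_X,
    Complex.ofRealHom_eq_coe, div_eq_mul_inv, C_mul]
  simp
  ring

theorem realOpuc_coeff (c : ℤ → ℝ) (n : ℕ) (l : Fin (n + 1)) :
    (realOpuc c n).coeff l = opucCofactor c n l / realToeplitzDet c n := by
  simp only [realOpuc, finsetSum_coeff, coeff_C_mul, coeff_X_pow, Fin.val_inj, mul_ite, mul_one,
    mul_zero, Finset.sum_ite_eq, Finset.mem_univ, if_true]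

theorem realOpuc_natDegree_le (c : ℤ → ℝ) (n : ℕ) : (realOpuc c n).natDegree ≤ n := by
  refine natDegree_sum_le_of_forall_le _ _ fun l _ => (natDegree_C_mul_X_pow_le _ _).trans ?_
  exact Nat.lt_succ_iff.1 l.2

theorem realToeplitzDet_ne_zero {c : ℤ → ℝ}
    (hpos : ∀ m, (toeplitz (fun j => (c j : ℂ)) m).PosDef) (n : ℕ) : realToeplitzDet c n ≠ 0 := by
  have h := (hpos n).det_pos.ne'
  rw [toeplitz_det_ofReal] at h
  exact_mod_cast h

theorem realOpuc_coeff_self {c : ℤ → ℝ} (n : ℕ) (hn : realToeplitzDet c n ≠ 0) :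
    (realOpuc c n).coeff n = 1 := by
  have h := realOpuc_coeff c n (Fin.last n)
  rw [Fin.val_last] at h
  rw [h, div_eq_one_iff_eq hn, opucCofactor, realToeplitzDet]
  simp only [Fin.val_last, ← two_mul, pow_mul, Fin.succAbove_last]
  norm_num
  rw [← Matrix.det_transpose]
  rfl

theorem realOpuc_monic {c : ℤ → ℝ} (n : ℕ) (hn : realToeplitzDet c n ≠ 0) :
    (realOpuc c n).Monic :=
  monic_of_natDegree_le_of_coeff_eq_one n (realOpuc_natDegree_le c n) (realOpuc_coeff_self n hn)

theorem realOpuc_natDegree {c : ℤ → ℝ} (n : ℕ) (hn : realToeplitzDet c n ≠ 0) :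
    (realOpuc c n).natDegree = n :=
  natDegree_eq_of_le_of_coeff_ne_zero (realOpuc_natDegree_le c n)
    (by rw [realOpuc_coeff_self n hn]; exact one_ne_zero)

/-- Pairing with X^j turns the last row of the defining determinant into a copy of row j, and a
determinant with two equal rows vanishes. -/
theorem momentForm_X_pow_realOpuc (c : ℤ → ℝ) {n j : ℕ} (hj : j < n) :
    momentForm c (X ^ j) (realOpuc c n) = 0 := by
  let M : Matrix (Fin (n + 1)) (Fin (n + 1)) ℝ := Matrix.of fun i l =>
    if (i : ℕ) < n then c ((i : ℤ) - (l : ℤ)) else c ((j : ℤ) - (l : ℤ))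
  have hM : M.det = 0 := by
    refine Matrix.det_zero_of_row_eq (i := Fin.castSucc ⟨j, hj⟩) (j := Fin.last n)
      (Fin.castSucc_lt_last _).ne ?_
    ext l
    simp [M, hj]
  rw [Matrix.det_succ_row _ (Fin.last n)] at hM
  have e : momentForm c (X ^ j) (realOpuc c n) = (∑ l : Fin (n + 1),
      (-1) ^ ((Fin.last n : ℕ) + (l : ℕ)) * M (Fin.last n) l *
        (M.submatrix (Fin.last n).succAbove l.succAbove).det) / realToeplitzDet c n := by
    rw [realOpuc, map_sum, Finset.sum_div]
    refine Finset.sum_congr rfl fun l _ => ?_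
    have h : M.submatrix (Fin.last n).succAbove l.succAbove =
        Matrix.of fun i m : Fin n => c ((i : ℤ) - ((l.succAbove m : Fin (n + 1)) : ℕ)) := by
      ext i m
      simp [M]
    rw [momentForm_C_mul_right, momentForm_X_pow, h, opucCofactor]
    simp only [M, Matrix.of_apply, Fin.val_last, lt_irrefl, if_false]
    ring
  rw [e, hM, zero_div]

/-! ### Reversed and paraorthogonal polynomials -/

theorem reflect_coeff_of_le {p : ℝ[X]} {n i : ℕ} (hi : i ≤ n) :
    (p.reflect n).coeff i = p.coeff (n - i) := by
  rw [coeff_reflect, revAt_le hi]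

theorem reflect_natDegree_le {p : ℝ[X]} {n : ℕ} (hp : p.natDegree ≤ n) :
    (p.reflect n).natDegree ≤ n :=
  natDegree_reflect_le.trans (max_le le_rfl hp)

/-- Substituting l ↦ n - l changes j - l into -((n - j) - l), and the moments are even. -/
theorem momentForm_X_pow_reflect {c : ℤ → ℝ} (hc : ∀ j, c (-j) = c j) {p : ℝ[X]} {n j : ℕ}
    (hp : p.natDegree ≤ n) (hj : j ≤ n) :
    momentForm c (X ^ j) (p.reflect n) = momentForm c (X ^ (n - j)) p := by
  have h (q : ℝ[X]) (hq : q.natDegree ≤ n) (i : ℕ) : momentForm c (X ^ i) q =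
      ∑ l ∈ Finset.range (n + 1), q.coeff l * c ((i : ℤ) - (l : ℤ)) := by
    conv_lhs => rw [q.as_sum_range' (n + 1) (Nat.lt_succ_of_le hq), map_sum]
    refine Finset.sum_congr rfl fun l _ => ?_
    rw [X_pow_eq_monomial, momentForm_monomial, one_mul]
  rw [h _ (reflect_natDegree_le hp), h _ hp, ← Finset.sum_range_reflect]
  refine Finset.sum_congr rfl fun l hl => ?_
  have hl' : l ≤ n := Nat.lt_succ_iff.1 (Finset.mem_range.1 hl)
  rw [reflect_coeff_of_le (by omega), ← hc, show n - (n + 1 - 1 - l) = l by omega]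
  congr 2
  omega

/-- The polynomial `X Q + a Q^*`, where `Q` is the monic orthogonal polynomial of degree `n`. -/
noncomputable def realPopuc (c : ℤ → ℝ) (n : ℕ) (a : ℝ) : ℝ[X] :=
  X * realOpuc c n + C a * (realOpuc c n).reflect n

theorem popuc_ofReal (c : ℤ → ℝ) (n : ℕ) :
    popuc (fun j => (c j : ℂ)) n (-1) = (realPopuc c n 1).map Complex.ofRealHom := by
  have e : ((realOpuc c n).map Complex.ofRealHom).map (starRingEnd ℂ) =
      (realOpuc c n).map Complex.ofRealHom := by
    ext i; simp
  rw [popuc, opucStar, opuc_ofReal, e, reflect_map, realPopuc]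
  simp

theorem realPopuc_natDegree_le (c : ℤ → ℝ) (n : ℕ) (a : ℝ) :
    (realPopuc c n a).natDegree ≤ n + 1 := by
  have h := realOpuc_natDegree_le c n
  refine natDegree_add_le_of_degree_le ?_ ?_
  · refine natDegree_mul_le.trans ?_
    rw [natDegree_X]; omega
  · exact (natDegree_C_mul_le _ _).trans ((reflect_natDegree_le h).trans (Nat.le_succ n))

theorem realPopuc_coeff_succ {c : ℤ → ℝ} (n : ℕ) (hn : realToeplitzDet c n ≠ 0) (a : ℝ) :
    (realPopuc c n a).coeff (n + 1) = 1 := by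
  rw [realPopuc, coeff_add, coeff_X_mul, realOpuc_coeff_self n hn, coeff_C_mul,
    coeff_eq_zero_of_natDegree_lt
      (Nat.lt_succ_of_le (reflect_natDegree_le (realOpuc_natDegree_le c n)))]
  simp

theorem realPopuc_monic {c : ℤ → ℝ} (n : ℕ) (hn : realToeplitzDet c n ≠ 0) (a : ℝ) :
    (realPopuc c n a).Monic :=
  monic_of_natDegree_le_of_coeff_eq_one (n + 1) (realPopuc_natDegree_le c n a)
    (realPopuc_coeff_succ n hn a)

theorem realPopuc_natDegree {c : ℤ → ℝ} (n : ℕ) (hn : realToeplitzDet c n ≠ 0) (a : ℝ) :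
    (realPopuc c n a).natDegree = n + 1 :=
  natDegree_eq_of_le_of_coeff_ne_zero (realPopuc_natDegree_le c n a)
    (by rw [realPopuc_coeff_succ n hn]; exact one_ne_zero)

theorem realPopuc_coeff_zero {c : ℤ → ℝ} (n : ℕ) (hn : realToeplitzDet c n ≠ 0) (a : ℝ) :
    (realPopuc c n a).coeff 0 = a := by
  rw [realPopuc, coeff_add, coeff_C_mul, reflect_coeff_of_le (Nat.zero_le n), Nat.sub_zero,
    realOpuc_coeff_self n hn]
  simp

theorem momentForm_X_pow_realPopuc {c : ℤ → ℝ} (hc : ∀ j, c (-j) = c j) {n j : ℕ} (a : ℝ)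
    (hj : j < n) : momentForm c (X ^ (j + 1)) (realPopuc c n a) = 0 := by
  rw [realPopuc, map_add, pow_succ', momentForm_X_mul_X_mul, momentForm_X_pow_realOpuc c hj,
    momentForm_C_mul_right, ← pow_succ',
    momentForm_X_pow_reflect hc (realOpuc_natDegree_le c n) hj,
    momentForm_X_pow_realOpuc c (by omega), mul_zero, add_zero]

theorem momentForm_X_mul_realPopuc {c : ℤ → ℝ} (hc : ∀ j, c (-j) = c j) {n : ℕ} (a : ℝ)
    {p : ℝ[X]} (hp : p.natDegree < n) : momentForm c (X * p) (realPopuc c n a) = 0 := by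
  conv_lhs => rw [p.as_sum_range' n hp, Finset.mul_sum, map_sum, LinearMap.sum_apply]
  refine Finset.sum_eq_zero fun i hi => ?_
  rw [← C_mul_X_pow_eq_monomial, mul_left_comm, ← pow_succ', momentForm_C_mul_left,
    momentForm_X_pow_realPopuc hc a (Finset.mem_range.1 hi), mul_zero]

theorem momentForm_X_mul_popuc {c : ℤ → ℝ} (hc : ∀ j, c (-j) = c j) {n : ℕ}
    {p : ℂ[X]} (hp : p.natDegree < n) :
    momentForm (fun j => (c j : ℂ)) (X * p) (popuc (fun j => (c j : ℂ)) n (-1)) = 0 := by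
  conv_lhs => rw [p.as_sum_range' n hp, Finset.mul_sum, map_sum, LinearMap.sum_apply]
  refine Finset.sum_eq_zero fun i hi => ?_
  rw [← C_mul_X_pow_eq_monomial, mul_left_comm, ← pow_succ', momentForm_C_mul_left, popuc_ofReal]
  have h := momentForm_map Complex.ofRealHom c (X ^ (i + 1)) (realPopuc c n 1)
  simp only [Complex.ofRealHom_eq_coe, Polynomial.map_pow, map_X] at h
  rw [h, momentForm_X_pow_realPopuc hc 1 (Finset.mem_range.1 hi)]
  simp

/-! ### Zeros are simple and lie on the unit circle -/

/-- A paraorthogonal polynomial has no factor `(X - α) (X - 1 / conj α)`. -/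
theorem popuc_not_mul_dvd {c : ℤ → ℝ} (hc : ∀ j, c (-j) = c j)
    (hpos : ∀ m, (toeplitz (fun j => (c j : ℂ)) m).PosDef) {n : ℕ} {α β : ℂ}
    (hαβ : (starRingEnd ℂ) α * β = 1) :
    ¬ (X - C α) * (X - C β) ∣ popuc (fun j => (c j : ℂ)) n (-1) := by
  rintro ⟨g, hg⟩
  have hdet := realToeplitzDet_ne_zero hpos n
  have hmonic : (popuc (fun j => (c j : ℂ)) n (-1)).Monic := by
    rw [popuc_ofReal]; exact (realPopuc_monic n hdet 1).map _
  have hdeg : (popuc (fun j => (c j : ℂ)) n (-1)).natDegree = n + 1 := by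
    rw [popuc_ofReal, natDegree_map, realPopuc_natDegree n hdet]
  have hm2 : ((X - C α) * (X - C β)).Monic := (monic_X_sub_C α).mul (monic_X_sub_C β)
  have hg0 : g ≠ 0 := by
    rintro rfl
    rw [mul_zero] at hg
    exact hmonic.ne_zero hg
  have hgdeg : g.natDegree < n := by
    rw [hg, hm2.natDegree_mul' hg0, (monic_X_sub_C α).natDegree_mul (monic_X_sub_C β),
      natDegree_X_sub_C, natDegree_X_sub_C] at hdeg
    omega
  have h0 := momentForm_X_mul_popuc hc (n := n) (p := g.map (starRingEnd ℂ))
    (by rwa [natDegree_map])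
  set u : ℂ[X] := (X - C α) * g with hu
  have hu0 : u ≠ 0 := mul_ne_zero (X_sub_C_ne_zero α) hg0
  have hP := momentForm_conj_self_pos (c := fun j => (c j : ℂ)) (fun j => by rw [hc]) hpos hu0
  -- As conj α · β = 1, -conj α · P = u - conj α · X u. Pairing this with X conj(g) and using shift
  -- invariance reproduces ⟨u, u⟩, which must then vanish because deg g < n.
  have e : momentForm (fun j => (c j : ℂ)) (u.map (starRingEnd ℂ)) u =
      -(starRingEnd ℂ) α * momentForm (fun j => (c j : ℂ)) (X * g.map (starRingEnd ℂ))
        (popuc (fun j => (c j : ℂ)) n (-1)) := by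
    have e1 : u.map (starRingEnd ℂ) = X * g.map (starRingEnd ℂ) -
        C ((starRingEnd ℂ) α) * g.map (starRingEnd ℂ) := by
      rw [hu, Polynomial.map_mul, Polynomial.map_sub, map_X, map_C, sub_mul]
    have e2 : C (-(starRingEnd ℂ) α) * popuc (fun j => (c j : ℂ)) n (-1) =
        u - C ((starRingEnd ℂ) α) * (X * u) := by
      have h1 : (C ((starRingEnd ℂ) α) : ℂ[X]) * C β = 1 := by rw [← C_mul, hαβ, C_1]
      rw [hg, hu, C_neg]
      linear_combination (X - C α) * g * h1
    rw [← momentForm_C_mul_right, e2, e1, map_sub, LinearMap.sub_apply, momentForm_C_mul_left,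
      map_sub, momentForm_C_mul_right, momentForm_X_mul_X_mul]
  rw [e, h0, mul_zero] at hP
  exact lt_irrefl _ hP

theorem realPopuc_reflect (c : ℤ → ℝ) (n : ℕ) :
    (realPopuc c n 1).reflect (n + 1) = realPopuc c n 1 := by
  have h := realOpuc_natDegree_le c n
  have h1 : (X * realOpuc c n).reflect (n + 1) = (realOpuc c n).reflect n := by
    rw [add_comm n 1, reflect_mul _ _ natDegree_X_le h, reflect_one_X, one_mul]
  have h2 : ((realOpuc c n).reflect n).reflect (n + 1) = X * realOpuc c n := by
    rw [← h1, reflect_reflect]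
  rw [realPopuc, C_1, one_mul, reflect_add, h1, h2, add_comm]

/-- P is real and equal to its own reversal, so 1/conj α is a zero along with α. Off the unit circle
the two are distinct and give a forbidden factor. -/
theorem popuc_isRoot_norm {c : ℤ → ℝ} (hc : ∀ j, c (-j) = c j)
    (hpos : ∀ m, (toeplitz (fun j => (c j : ℂ)) m).PosDef) {n : ℕ} {α : ℂ}
    (h : (popuc (fun j => (c j : ℂ)) n (-1)).IsRoot α) : ‖α‖ = 1 := by
  have hdet := realToeplitzDet_ne_zero hpos n
  by_contra hα
  have hα0 : α ≠ 0 := by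
    rintro rfl
    rw [IsRoot.def, ← coeff_zero_eq_eval_zero, popuc_ofReal, coeff_map,
      realPopuc_coeff_zero n hdet] at h
    simp at h
  have hcα0 : (starRingEnd ℂ) α ≠ 0 := by simpa using hα0
  have hβ : (popuc (fun j => (c j : ℂ)) n (-1)).IsRoot ((starRingEnd ℂ) α)⁻¹ := by
    rw [popuc_ofReal, IsRoot.def, eval_map] at h ⊢
    let _ := invertibleOfNonzero hcα0
    have h2 := (eval₂_reflect_eq_zero_iff Complex.ofRealHom ((starRingEnd ℂ) α) (n + 1)
      (realPopuc c n 1) (realPopuc_natDegree_le c n 1)).2 (by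
        have := congrArg (starRingEnd ℂ) h
        have e : (starRingEnd ℂ).comp Complex.ofRealHom = Complex.ofRealHom := by ext x; simp
        rwa [hom_eval₂, map_zero, e] at this)
    rwa [realPopuc_reflect, invOf_eq_inv] at h2
  have hne : α ≠ ((starRingEnd ℂ) α)⁻¹ := by
    intro e
    have e2 : (starRingEnd ℂ) α * α = 1 := by
      conv_lhs => rw [e, map_inv₀, Complex.conj_conj]
      rw [← e, inv_mul_cancel₀ hα0]
    rw [mul_comm, Complex.mul_conj'] at e2
    have : ‖α‖ ^ 2 = 1 := by exact_mod_cast e2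
    exact hα (by nlinarith [norm_nonneg α, sq_nonneg (‖α‖ - 1)])
  refine popuc_not_mul_dvd hc hpos (n := n) (α := α) (β := ((starRingEnd ℂ) α)⁻¹)
    (mul_inv_cancel₀ hcα0) ?_
  exact (isCoprime_X_sub_C_of_isUnit_sub (sub_ne_zero.2 hne).isUnit).mul_dvd
    (dvd_iff_isRoot.2 h) (dvd_iff_isRoot.2 hβ)

/-- On the unit circle 1/conj α = α, so a double zero is the same forbidden factor. -/
theorem popuc_derivative_ne_zero {c : ℤ → ℝ} (hc : ∀ j, c (-j) = c j)
    (hpos : ∀ m, (toeplitz (fun j => (c j : ℂ)) m).PosDef) {n : ℕ} {α : ℂ}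
    (h : (popuc (fun j => (c j : ℂ)) n (-1)).IsRoot α) :
    (derivative (popuc (fun j => (c j : ℂ)) n (-1))).eval α ≠ 0 := by
  intro hd
  have hdet := realToeplitzDet_ne_zero hpos n
  have hne : popuc (fun j => (c j : ℂ)) n (-1) ≠ 0 := by
    rw [popuc_ofReal]; exact ((realPopuc_monic n hdet 1).map _).ne_zero
  have h2 := (le_rootMultiplicity_iff hne).1 ((one_lt_rootMultiplicity_iff_isRoot hne).2 ⟨h, hd⟩)
  rw [pow_succ, pow_one] at h2
  refine popuc_not_mul_dvd hc hpos ?_ h2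
  rw [mul_comm, Complex.mul_conj', popuc_isRoot_norm hc hpos h]
  simp

/-! ### Positive coefficients of Hurwitz polynomials -/

/-- All coefficients of `p` up to its degree are positive. -/
def HasPosCoeffs (p : ℝ[X]) : Prop := ∀ i ≤ p.natDegree, 0 < p.coeff i

theorem HasPosCoeffs.coeff_nonneg {p : ℝ[X]} (hp : HasPosCoeffs p) (i : ℕ) : 0 ≤ p.coeff i := by
  rcases le_or_gt i p.natDegree with h | h
  · exact (hp i h).le
  · rw [coeff_eq_zero_of_natDegree_lt h]

theorem HasPosCoeffs.ne_zero {p : ℝ[X]} (hp : HasPosCoeffs p) : p ≠ 0 := by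
  rintro rfl
  simpa using hp 0 (Nat.zero_le _)

theorem HasPosCoeffs.mul {p q : ℝ[X]} (hp : HasPosCoeffs p) (hq : HasPosCoeffs q) :
    HasPosCoeffs (p * q) := by
  intro m hm
  rw [natDegree_mul hp.ne_zero hq.ne_zero] at hm
  rw [coeff_mul]
  refine Finset.sum_pos' (fun x _ => mul_nonneg (hp.coeff_nonneg _) (hq.coeff_nonneg _))
    ⟨(min m p.natDegree, m - min m p.natDegree), ?_, ?_⟩
  · rw [Finset.HasAntidiagonal.mem_antidiagonal]; simp
  · exact mul_pos (hp _ (min_le_right _ _)) (hq _ (by simp only; omega))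

theorem hasPosCoeffs_X_sub_C {a : ℝ} (ha : a < 0) : HasPosCoeffs (X - C a) := by
  intro i hi
  rw [natDegree_X_sub_C] at hi
  interval_cases i <;> simp [coeff_X, coeff_C, ha]

theorem quadratic_natDegree (a b : ℝ) : (X ^ 2 - C a * X + C b : ℝ[X]).natDegree = 2 := by
  compute_degree!

theorem quadratic_monic (a b : ℝ) : (X ^ 2 - C a * X + C b : ℝ[X]).Monic := by
  monicity!

theorem hasPosCoeffs_quadratic {a b : ℝ} (ha : a < 0) (hb : 0 < b) :
    HasPosCoeffs (X ^ 2 - C a * X + C b) := by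
  intro i hi
  rw [quadratic_natDegree] at hi
  interval_cases i <;> simp [coeff_X, coeff_C, coeff_X_pow, ha, hb]

/-- A monic real Hurwitz polynomial has positive coefficients. -/
theorem hasPosCoeffs_of_isHurwitz {p : ℝ[X]} (hp : p.Monic)
    (h : IsHurwitz (p.map Complex.ofRealHom)) : HasPosCoeffs p := by
  induction hd : p.natDegree using Nat.strong_induction_on generalizing p with
  | _ d ih =>
    -- Split off a real factor: X - a with a < 0 for a real zero, X² - 2 Re(z) X + |z|² for a
    -- nonreal one. Both have positive coefficients, a property stable under products.
    have step : ∀ q r : ℝ[X], p = q * r → q.Monic → 0 < q.natDegree → HasPosCoeffs q →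
        HasPosCoeffs p := by
      intro q r e hq hqd hqp
      have hr : r.Monic := hq.of_mul_monic_left (e ▸ hp)
      rw [e]
      refine hqp.mul (ih r.natDegree ?_ hr ?_ rfl)
      · rw [e, hq.natDegree_mul hr] at hd; omega
      · intro z hz
        refine h z ?_
        rw [IsRoot.def] at hz ⊢
        rw [e, Polynomial.map_mul, eval_mul, hz, mul_zero]
    rcases Nat.eq_zero_or_pos d with h0 | hpos
    · intro i hi
      rw [hd, h0, Nat.le_zero] at hi
      have := hp.coeff_natDegree
      rw [hd, h0] at this
      rw [hi, this]; exact one_pos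
    · obtain ⟨z, hz⟩ := IsAlgClosed.exists_root (p.map Complex.ofRealHom) (by
        rw [degree_map, degree_eq_natDegree hp.ne_zero, hd]
        exact_mod_cast hpos.ne')
      have hre := h z hz
      have hz' : aeval z p = 0 := by
        rw [IsRoot.def, eval_map] at hz
        exact hz
      by_cases him : z.im = 0
      · have ez : z = (z.re : ℂ) := Complex.ext rfl (by simp [him])
        have hroot : p.IsRoot z.re := by
          rw [ez, ← Complex.ofRealHom_eq_coe] at hz
          exact (isRoot_map_iff Complex.ofRealHom.injective).1 hz
        obtain ⟨r, hr⟩ := dvd_iff_isRoot.2 hroot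
        exact step _ r hr (monic_X_sub_C _) (by rw [natDegree_X_sub_C]; exact one_pos)
          (hasPosCoeffs_X_sub_C hre)
      · obtain ⟨r, hr⟩ := quadratic_dvd_of_aeval_eq_zero_im_ne_zero p hz' him
        have hz0 : z ≠ 0 := by rintro rfl; simp at him
        refine step _ r hr (quadratic_monic _ _) (by rw [quadratic_natDegree]; exact two_pos)
          (hasPosCoeffs_quadratic (by linarith) ?_)
        positivity

/-! ### The Christoffel–Darboux kernel at -1 -/

theorem momentForm_eq_zero_of_X_pow {c : ℤ → ℝ} {q : ℝ[X]} {n : ℕ}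
    (h : ∀ i < n, momentForm c (X ^ i) q = 0) {p : ℝ[X]} (hp : p.degree < n) :
    momentForm c p q = 0 := by
  rcases eq_or_ne p 0 with rfl | hp0
  · simp
  have hp' : p.natDegree < n := (natDegree_lt_iff_degree_lt hp0).2 hp
  conv_lhs => rw [p.as_sum_range' n hp', map_sum, LinearMap.sum_apply]
  refine Finset.sum_eq_zero fun i hi => ?_
  rw [← C_mul_X_pow_eq_monomial, momentForm_C_mul_left, h i (Finset.mem_range.1 hi), mul_zero]

theorem realOpuc_degree {c : ℤ → ℝ} (n : ℕ) (hn : realToeplitzDet c n ≠ 0) :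
    (realOpuc c n).degree = n := by
  rw [degree_eq_natDegree (realOpuc_monic n hn).ne_zero, realOpuc_natDegree n hn]

section kernel

variable {c : ℤ → ℝ} (hc : ∀ j, c (-j) = c j)
  (hpos : ∀ m, (toeplitz (fun j => (c j : ℂ)) m).PosDef)

include hc hpos in
theorem momentForm_realOpuc_of_ne {i j : ℕ} (h : i ≠ j) :
    momentForm c (realOpuc c i) (realOpuc c j) = 0 := by
  have key : ∀ i j : ℕ, i < j → momentForm c (realOpuc c i) (realOpuc c j) = 0 := by
    intro i j h
    refine momentForm_eq_zero_of_X_pow (n := j) (fun l hl => momentForm_X_pow_realOpuc c hl) ?_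
    rw [realOpuc_degree i (realToeplitzDet_ne_zero hpos i)]
    exact_mod_cast h
  rcases lt_or_gt_of_ne h with h | h
  · exact key _ _ h
  · rw [momentForm_comm hc]; exact key _ _ h

-- Each Q_i is monic of degree i, so by induction p is orthogonal to all X^i with i ≤ n, hence to
-- itself.
include hc hpos in
theorem eq_zero_of_momentForm_realOpuc {n : ℕ} {p : ℝ[X]} (hp : p.natDegree ≤ n)
    (h : ∀ i ≤ n, momentForm c (realOpuc c i) p = 0) : p = 0 := by
  have hX : ∀ i < n + 1, momentForm c (X ^ i) p = 0 := by
    intro i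
    induction i using Nat.strong_induction_on with
    | _ i ih =>
      intro hi
      have hdet := realToeplitzDet_ne_zero hpos i
      have hlt : (X ^ i - realOpuc c i).degree < (i : WithBot ℕ) := by
        have := degree_sub_lt_left (p := X ^ i) (q := realOpuc c i)
          (by rw [degree_X_pow, realOpuc_degree i hdet]) (monic_X_pow i).ne_zero
          (by rw [(monic_X_pow i).leadingCoeff, (realOpuc_monic i hdet).leadingCoeff])
        rwa [degree_X_pow] at this
      have h0 := momentForm_eq_zero_of_X_pow (fun l hl => ih l hl (hl.trans hi)) hlt
      rw [map_sub, LinearMap.sub_apply, h i (Nat.lt_succ_iff.1 hi), sub_zero] at h0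
      exact h0
  by_contra hne
  refine (momentForm_self_pos hc hpos hne).ne' (momentForm_eq_zero_of_X_pow hX ?_)
  rw [degree_eq_natDegree hne]
  exact_mod_cast Nat.lt_succ_of_le hp

/-- The Christoffel–Darboux kernel `K_n(-1, ·)` as a real polynomial. -/
noncomputable def realKernel (c : ℤ → ℝ) (n : ℕ) : ℝ[X] :=
  ∑ j ∈ Finset.range (n + 1),
    C ((realOpuc c j).eval (-1) / momentForm c (realOpuc c j) (realOpuc c j)) * realOpuc c j

-- The two normalizing factors 1/‖Q_j‖ combine to 1/⟨Q_j, Q_j⟩, so no square root survives.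
include hc hpos in
theorem cdKernel_ofReal (n : ℕ) :
    cdKernel (fun j => (c j : ℂ)) n (-1) = (realKernel c n).map Complex.ofRealHom := by
  rw [cdKernel, realKernel, Polynomial.map_sum]
  refine Finset.sum_congr rfl fun j _ => ?_
  have hQ := (realOpuc_monic j (realToeplitzDet_ne_zero hpos j)).ne_zero
  have hQp := momentForm_self_pos hc hpos hQ
  have e : ((realOpuc c j).map Complex.ofRealHom).map (starRingEnd ℂ) =
      (realOpuc c j).map Complex.ofRealHom := by
    ext i; simp
  have hnorm : momentNorm (fun j => (c j : ℂ)) (opuc (fun j => (c j : ℂ)) j) =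
      √(momentForm c (realOpuc c j) (realOpuc c j)) := by
    have h2 := momentForm_map Complex.ofRealHom c (realOpuc c j) (realOpuc c j)
    simp only [Complex.ofRealHom_eq_coe] at h2
    rw [momentNorm, momentInner_eq_momentForm, opuc_ofReal, e, h2, Complex.ofReal_re]
  have hev : ((realOpuc c j).map Complex.ofRealHom).eval (-1) =
      (((realOpuc c j).eval (-1) : ℝ) : ℂ) := by
    have := eval_map_apply Complex.ofRealHom (p := realOpuc c j) (-1)
    simpa using this
  rw [opucNormalized, hnorm, opuc_ofReal, eval_mul, eval_C, hev, Polynomial.map_mul, map_C,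
    ← mul_assoc, ← C_mul]
  congr 2
  rw [map_mul, Complex.conj_ofReal, Complex.conj_ofReal, Complex.ofRealHom_eq_coe]
  rw [← Complex.ofReal_mul, ← Complex.ofReal_mul]
  congr 1
  rw [mul_right_comm, ← mul_inv, Real.mul_self_sqrt hQp.le, mul_comm, div_eq_mul_inv]

include hc hpos in
theorem momentForm_realOpuc_realKernel {n i : ℕ} (hi : i ≤ n) :
    momentForm c (realOpuc c i) (realKernel c n) = (realOpuc c i).eval (-1) := by
  have hQ := (realOpuc_monic i (realToeplitzDet_ne_zero hpos i)).ne_zero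
  have hQp := momentForm_self_pos hc hpos hQ
  rw [realKernel, map_sum, Finset.sum_eq_single i]
  · rw [momentForm_C_mul_right, div_mul_cancel₀ _ hQp.ne']
  · intro j _ hj
    rw [momentForm_C_mul_right, momentForm_realOpuc_of_ne hc hpos hj.symm, mul_zero]
  · intro h
    exact absurd (Finset.mem_range.2 (Nat.lt_succ_of_le hi)) h

theorem realKernel_natDegree_le (c : ℤ → ℝ) (n : ℕ) : (realKernel c n).natDegree ≤ n := by
  refine natDegree_sum_le_of_forall_le _ _ fun j hj => (natDegree_C_mul_le _ _).trans ?_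
  exact (realOpuc_natDegree_le c j).trans (Nat.lt_succ_iff.1 (Finset.mem_range.1 hj))

theorem eval_neg_one_reflect {p : ℝ[X]} {n : ℕ} (hp : p.natDegree ≤ n) :
    (p.reflect n).eval (-1) = (-1) ^ n * p.eval (-1) := by
  let _ : Invertible (-1 : ℝ) := invertibleOfNonzero (by norm_num)
  have h := eval₂_reflect_mul_pow (RingHom.id ℝ) (-1) n p hp
  rw [invOf_eq_inv, inv_neg_one, ← eval, ← eval] at h
  rw [← h, mul_comm, mul_assoc, ← mul_pow]
  simp

include hc hpos in
/-- The Christoffel–Darboux formula at `-1`: up to a nonzero factor, `(X + 1) K_n(-1, X)` is a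
paraorthogonal polynomial. -/
theorem exists_realPopuc_eq_mul_realKernel (n : ℕ) : ∃ κ : ℝ, κ ≠ 0 ∧
    realPopuc c n ((-1) ^ n) = (X - C (-1)) * (C κ * realKernel c n) := by
  have hdet := realToeplitzDet_ne_zero hpos n
  -- The parameter (-1)^n is chosen for this: Q_n^*(-1) = (-1)^n Q_n(-1).
  have hroot : (realPopuc c n ((-1) ^ n)).IsRoot (-1) := by
    rw [IsRoot.def, realPopuc, eval_add, eval_mul, eval_X, eval_mul, eval_C,
      eval_neg_one_reflect (realOpuc_natDegree_le c n), ← mul_assoc, ← mul_pow]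
    simp
  obtain ⟨R, hR⟩ := dvd_iff_isRoot.2 hroot
  have hRm : R.Monic := (monic_X_sub_C (-1 : ℝ)).of_mul_monic_left
    (hR ▸ realPopuc_monic n hdet _)
  have hRd : R.natDegree = n := by
    have := realPopuc_natDegree n hdet ((-1) ^ n)
    rw [hR, (monic_X_sub_C (-1 : ℝ)).natDegree_mul hRm, natDegree_X_sub_C] at this
    omega
  -- Since (X + 1) R is orthogonal to X^(i+1), shift invariance gives ⟨X^(i+1), R⟩ = -⟨X^i, R⟩. So R
  -- reproduces evaluation at -1 up to the constant ⟨1, R⟩, which identifies it with a multiple of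
  -- the kernel.
  have hX : ∀ i ≤ n, momentForm c (X ^ i) R = (-1) ^ i * momentForm c 1 R := by
    intro i
    induction i with
    | zero => intro _; simp
    | succ i ih =>
      intro hi
      have h := momentForm_X_pow_realPopuc hc ((-1) ^ n) (Nat.lt_of_succ_le hi)
      rw [hR, sub_mul, map_sub, momentForm_C_mul_right, pow_succ', momentForm_X_mul_X_mul,
        ih (by omega), ← pow_succ'] at h
      rw [pow_succ (-1 : ℝ)]
      linear_combination h
  have hrep : ∀ p : ℝ[X], p.natDegree ≤ n →
      momentForm c p R = momentForm c 1 R * p.eval (-1) := by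
    intro p hp
    rw [eval_eq_sum_range' (Nat.lt_succ_of_le hp), Finset.mul_sum]
    conv_lhs => rw [p.as_sum_range' (n + 1) (Nat.lt_succ_of_le hp), map_sum, LinearMap.sum_apply]
    refine Finset.sum_congr rfl fun i hi => ?_
    rw [← C_mul_X_pow_eq_monomial, momentForm_C_mul_left,
      hX i (Nat.lt_succ_iff.1 (Finset.mem_range.1 hi))]
    ring
  have hRK : R - C (momentForm c 1 R) * realKernel c n = 0 := by
    refine eq_zero_of_momentForm_realOpuc hc hpos (n := n) ?_ fun i hi => ?_
    · exact (natDegree_sub_le_of_le hRd.le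
        ((natDegree_C_mul_le _ _).trans (realKernel_natDegree_le c n))).trans (max_self n).le
    · rw [map_sub, momentForm_C_mul_right, momentForm_realOpuc_realKernel hc hpos hi,
        hrep _ ((realOpuc_natDegree_le c i).trans hi), sub_self]
  have hRK' := sub_eq_zero.1 hRK
  refine ⟨momentForm c 1 R, ?_, by rw [hR, ← hRK']⟩
  intro h0
  rw [h0, C_0, zero_mul] at hRK'
  exact hRm.ne_zero hRK'

-- For odd n the polynomial X Q_n - Q_n^* also vanishes at 1, because Q_n^*(1) = Q_n(1). The kernel
-- would then have the zero 1 in the right half-plane. Evenness makes the parameter (-1)^n equal to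
-- 1.
include hc hpos in
theorem even_of_isHurwitz_cdKernel {n : ℕ}
    (h : IsHurwitz (cdKernel (fun j => (c j : ℂ)) n (-1))) : Even n := by
  by_contra hodd
  rw [Nat.not_even_iff_odd] at hodd
  obtain ⟨κ, hκ, e⟩ := exists_realPopuc_eq_mul_realKernel hc hpos n
  have h1 : (realPopuc c n ((-1) ^ n)).eval 1 = 0 := by
    have hr : ((realOpuc c n).reflect n).eval 1 = (realOpuc c n).eval 1 := by
      let _ : Invertible (1 : ℝ) := invertibleOne
      have := eval₂_reflect_mul_pow (RingHom.id ℝ) 1 n _ (realOpuc_natDegree_le c n)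
      rw [invOf_one, one_pow, mul_one] at this
      exact this
    rw [realPopuc, eval_add, eval_mul, eval_mul, hr, hodd.neg_one_pow]
    simp
  have h2 : (realKernel c n).IsRoot 1 := by
    rw [e] at h1
    simp only [eval_mul, eval_sub, eval_X, eval_C, mul_eq_zero, hκ, false_or] at h1
    rcases h1 with h1 | h1
    · norm_num at h1
    · exact h1
  have h3 := h 1 (by
    rw [cdKernel_ofReal hc hpos, ← Complex.ofRealHom.map_one]
    exact h2.map)
  norm_num at h3

include hc hpos in
theorem exists_popuc_eq_mul_cdKernel {n : ℕ} (hn : Even n) : ∃ κ : ℂ, κ ≠ 0 ∧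
    popuc (fun j => (c j : ℂ)) n (-1) =
      (X + 1) * (C κ * cdKernel (fun j => (c j : ℂ)) n (-1)) := by
  obtain ⟨κ, hκ, e⟩ := exists_realPopuc_eq_mul_realKernel hc hpos n
  refine ⟨κ, by exact_mod_cast hκ, ?_⟩
  rw [popuc_ofReal, cdKernel_ofReal hc hpos, ← hn.neg_one_pow, e]
  simp

include hc hpos in
theorem isHurwitz_popuc {n : ℕ} (h : IsHurwitz (cdKernel (fun j => (c j : ℂ)) n (-1))) :
    IsHurwitz (popuc (fun j => (c j : ℂ)) n (-1)) := by
  obtain ⟨κ, hκ, e⟩ := exists_popuc_eq_mul_cdKernel hc hpos (even_of_isHurwitz_cdKernel hc hpos h)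
  intro z hz
  rw [e, IsRoot.def] at hz
  simp only [eval_mul, eval_add, eval_X, eval_one, eval_C, mul_eq_zero, hκ, false_or] at hz
  rcases hz with hz | hz
  · rw [eq_neg_of_add_eq_zero_left hz]; norm_num
  · exact h z hz

include hc hpos in
theorem popuc_isRoot_neg_one {n : ℕ}
    (h : IsHurwitz (cdKernel (fun j => (c j : ℂ)) n (-1))) :
    (popuc (fun j => (c j : ℂ)) n (-1)).IsRoot (-1) := by
  obtain ⟨κ, hκ, e⟩ := exists_popuc_eq_mul_cdKernel hc hpos (even_of_isHurwitz_cdKernel hc hpos h)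
  rw [e, IsRoot.def]
  simp

end kernel

/-! ### Smooth dependence of zeros on the parameter -/

open scoped Topology in
/-- Implicit function theorem for a simple zero of a polynomial whose coefficients depend
continuously differentiably on a real parameter. -/
theorem exists_implicit_zero {p : ℝ → ℂ[X]} {N : ℕ} (hdeg : ∀ t, (p t).natDegree ≤ N) {t₀ : ℝ}
    (hp : ∀ i, ContDiffAt ℝ 1 (fun t => (p t).coeff i) t₀) {z₀ : ℂ} (hz : (p t₀).IsRoot z₀)
    (hd : (derivative (p t₀)).eval z₀ ≠ 0) :
    ∃ g : ℝ → ℂ, ContDiffAt ℝ 1 g t₀ ∧ g t₀ = z₀ ∧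
      ∀ᶠ v : ℝ × ℂ in 𝓝 (t₀, z₀), (p v.1).IsRoot v.2 ↔ g v.1 = v.2 := by
  let F : ℝ × ℂ → ℂ := fun v => ∑ i ∈ Finset.range (N + 1), (p v.1).coeff i * v.2 ^ i
  have hF : ∀ v, F v = (p v.1).eval v.2 := fun v =>
    (eval_eq_sum_range' (Nat.lt_succ_of_le (hdeg v.1)) v.2).symm
  have cdf : ContDiffAt ℝ 1 F (t₀, z₀) := by
    refine ContDiffAt.sum fun i _ => ContDiffAt.mul ?_ (contDiffAt_snd.pow i)
    exact ContDiffAt.comp (t₀, z₀) (hp i) contDiffAt_fst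
  set a : ℂ := (derivative (p t₀)).eval z₀ with ha
  have h1 : HasFDerivAt (fun z => F (t₀, z)) (fderiv ℝ F (t₀, z₀) ∘L .inr ℝ ℝ ℂ) z₀ :=
    HasFDerivAt.comp z₀ ((cdf.differentiableAt one_ne_zero).hasFDerivAt)
      (hasFDerivAt_prodMk_right t₀ z₀)
  have h2 : HasFDerivAt (fun z => F (t₀, z))
      ((ContinuousLinearMap.toSpanSingleton ℂ a).restrictScalars ℝ) z₀ := by
    have := ((p t₀).hasDerivAt z₀).hasFDerivAt.restrictScalars ℝ
    simpa only [hF] using this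
  -- The partial derivative in z is multiplication by a = p'(z₀) ≠ 0, with inverse multiplication by
  -- a⁻¹.
  have hinv : (fderiv ℝ F (t₀, z₀) ∘L .inr ℝ ℝ ℂ).IsInvertible := by
    rw [h1.unique h2]
    refine ContinuousLinearMap.IsInvertible.of_inverse
      (g := (ContinuousLinearMap.toSpanSingleton ℂ a⁻¹).restrictScalars ℝ) ?_ ?_
    · ext; simp [hd]
    · ext; simp [hd]
  refine ⟨cdf.implicitFunction one_ne_zero hinv, cdf.contDiffAt_implicitFunction one_ne_zero hinv,
    cdf.implicitFunction_apply_self one_ne_zero hinv, ?_⟩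
  have h0 : F (t₀, z₀) = 0 := by rw [hF]; exact hz
  filter_upwards [cdf.eventually_apply_eq_iff_implicitFunction one_ne_zero hinv] with v hv
  rw [← hv, h0, hF]
  rfl

theorem ContDiffOn.matrix_det {m : ℕ} {J : Set ℝ} {M : ℝ → Matrix (Fin m) (Fin m) ℝ}
    (h : ∀ i j, ContDiffOn ℝ 1 (fun t => M t i j) J) : ContDiffOn ℝ 1 (fun t => (M t).det) J := by
  simp only [Matrix.det_apply]
  exact ContDiffOn.sum fun σ _ => (contDiffOn_prod fun i _ => h _ _).const_smul _

theorem contDiffOn_realOpuc_coeff {J : Set ℝ} {c : ℝ → ℤ → ℝ}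
    (h : ∀ j, ContDiffOn ℝ 1 (fun t => c t j) J)
    (hpos : ∀ t ∈ J, ∀ m, (toeplitz (fun j => (c t j : ℂ)) m).PosDef) (n i : ℕ) :
    ContDiffOn ℝ 1 (fun t => (realOpuc (c t) n).coeff i) J := by
  rcases Nat.lt_or_ge i (n + 1) with hi | hi
  · have e : ∀ t, (realOpuc (c t) n).coeff i =
        opucCofactor (c t) n ⟨i, hi⟩ / realToeplitzDet (c t) n := fun t =>
      realOpuc_coeff (c t) n ⟨i, hi⟩
    simp only [e]
    refine ContDiffOn.div ?_ ?_ fun t ht => realToeplitzDet_ne_zero (hpos t ht) n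
    · exact contDiffOn_const.mul (ContDiffOn.matrix_det fun i j => h _)
    · exact ContDiffOn.matrix_det fun i j => h _
  · have e : ∀ t, (realOpuc (c t) n).coeff i = 0 := fun t =>
      coeff_eq_zero_of_natDegree_lt ((realOpuc_natDegree_le (c t) n).trans_lt hi)
    simp only [e]
    exact contDiffOn_const

theorem contDiffOn_realPopuc_coeff {J : Set ℝ} {c : ℝ → ℤ → ℝ}
    (h : ∀ j, ContDiffOn ℝ 1 (fun t => c t j) J)
    (hpos : ∀ t ∈ J, ∀ m, (toeplitz (fun j => (c t j : ℂ)) m).PosDef) (n i : ℕ) (a : ℝ) :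
    ContDiffOn ℝ 1 (fun t => (realPopuc (c t) n a).coeff i) J := by
  simp only [realPopuc, coeff_add, coeff_C_mul, coeff_reflect]
  refine ContDiffOn.add ?_ (contDiffOn_const.mul (contDiffOn_realOpuc_coeff h hpos n _))
  cases i with
  | zero => simp only [coeff_X_mul_zero]; exact contDiffOn_const
  | succ i => simp only [coeff_X_mul]; exact contDiffOn_realOpuc_coeff h hpos n i

open scoped Topology in
theorem exists_popuc_zero {J : Set ℝ} (hJ : IsOpen J) {c : ℝ → ℤ → ℝ}
    (hc : ∀ t ∈ J, ∀ j, c t (-j) = c t j) (h : ∀ j, ContDiffOn ℝ 1 (fun t => c t j) J)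
    (hpos : ∀ t ∈ J, ∀ m, (toeplitz (fun j => (c t j : ℂ)) m).PosDef) {n : ℕ} {t₀ : ℝ}
    (ht₀ : t₀ ∈ J) {z₀ : ℂ} (hz : (popuc (fun j => (c t₀ j : ℂ)) n (-1)).IsRoot z₀) :
    ∃ g : ℝ → ℂ, ContDiffAt ℝ 1 g t₀ ∧ g t₀ = z₀ ∧
      ∀ᶠ v : ℝ × ℂ in 𝓝 (t₀, z₀),
        (popuc (fun j => (c v.1 j : ℂ)) n (-1)).IsRoot v.2 ↔ g v.1 = v.2 := by
  refine exists_implicit_zero (p := fun t => popuc (fun j => (c t j : ℂ)) n (-1)) (N := n + 1)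
    (fun t => ?_) (fun i => ?_) hz (popuc_derivative_ne_zero (hc t₀ ht₀) (hpos t₀ ht₀) hz)
  · rw [popuc_ofReal]
    exact natDegree_map_le.trans (realPopuc_natDegree_le _ _ _)
  · simp only [popuc_ofReal, coeff_map]
    exact Complex.ofRealCLM.contDiff.contDiffAt.comp t₀
      ((contDiffOn_realPopuc_coeff h hpos n i 1).contDiffAt (hJ.mem_nhds ht₀))

open scoped Topology in
theorem exists_unique_zeroBranch {J : Set ℝ} (hJ : IsOpen J) (hJ0 : (0 : ℝ) ∈ J) {c : ℝ → ℤ → ℝ}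
    (hc : ∀ t ∈ J, ∀ j, c t (-j) = c t j) (h : ∀ j, ContDiffOn ℝ 1 (fun t => c t j) J)
    (hpos : ∀ t ∈ J, ∀ m, (toeplitz (fun j => (c t j : ℂ)) m).PosDef) {n : ℕ}
    {ζ₀ : ℂ} (hz : (popuc (fun j => (c 0 j : ℂ)) n (-1)).IsRoot ζ₀) :
    ∃ ε > (0 : ℝ), ∃ δ > (0 : ℝ), Set.Ioo (-ε) ε ⊆ J ∧ ∃ ζ : ℝ → ℂ,
      IsZeroBranch (fun t => popuc (fun j => (c t j : ℂ)) n (-1)) ζ₀ ε δ ζ ∧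
      ∀ ζ' : ℝ → ℂ, IsZeroBranch (fun t => popuc (fun j => (c t j : ℂ)) n (-1)) ζ₀ ε δ ζ' →
        Set.EqOn ζ' ζ (Set.Ioo (-ε) ε) := by
  obtain ⟨g, hg, hg0, hev⟩ := exists_popuc_zero hJ hc h hpos hJ0 hz
  obtain ⟨δ, hδ, hball⟩ := Metric.eventually_nhds_iff_ball.1 hev
  have hgc : ∀ᶠ t in 𝓝 (0 : ℝ), g t ∈ Metric.ball ζ₀ δ :=
    hg.continuousAt (Metric.ball_mem_nhds _ hδ |> fun hb => by rwa [hg0])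
  have hgd : ∀ᶠ t in 𝓝 (0 : ℝ), DifferentiableAt ℝ g t := by
    filter_upwards [hg.eventually (by simp)] with t ht
    exact ht.differentiableAt one_ne_zero
  obtain ⟨η, hη, hηp⟩ := Metric.eventually_nhds_iff_ball.1
    (hgc.and (hgd.and (hJ.mem_nhds hJ0)))
  -- The ball of radius δ in ℝ × ℂ is a product of balls, so t must stay within δ as well as η. In
  -- that box the zeros are exactly the graph of g, whence uniqueness.
  have hmem : ∀ t ∈ Set.Ioo (-min η δ) (min η δ), t ∈ Metric.ball (0 : ℝ) η ∧
      t ∈ Metric.ball (0 : ℝ) δ := by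
    intro t ht
    simp only [Metric.mem_ball, Real.dist_eq, sub_zero]
    have := abs_lt.2 ht
    exact ⟨this.trans_le (min_le_left _ _), this.trans_le (min_le_right _ _)⟩
  have hiff : ∀ t ∈ Set.Ioo (-min η δ) (min η δ), ∀ z ∈ Metric.ball ζ₀ δ,
      ((popuc (fun j => (c t j : ℂ)) n (-1)).IsRoot z ↔ g t = z) := by
    intro t ht z hz
    refine hball (t, z) ?_
    rw [← ball_prod_same]
    exact ⟨(hmem t ht).2, hz⟩
  have hroot : ∀ t ∈ Set.Ioo (-min η δ) (min η δ),
      (popuc (fun j => (c t j : ℂ)) n (-1)).IsRoot (g t) := fun t ht =>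
    (hiff t ht _ (hηp t (hmem t ht).1).1).2 rfl
  refine ⟨min η δ, lt_min hη hδ, δ, hδ, fun t ht => (hηp t (hmem t ht).1).2.2, g, ⟨?_, ?_, hg0,
    hroot⟩, ?_⟩
  · intro t ht
    obtain ⟨h1, _, h3⟩ := hηp t (hmem t ht).1
    refine ⟨h1, ?_⟩
    rw [mem_sphere_zero_iff_norm]
    exact popuc_isRoot_norm (hc t h3) (hpos t h3) (hroot t ht)
  · exact fun t ht => (hηp t (hmem t ht).1).2.1.differentiableWithinAt
  · intro ζ' hζ' t ht
    exact ((hiff t ht _ (hζ'.mapsTo ht).1).1 (hζ'.isRoot t ht)).symm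

/-! ### Comparing zeros for two parameter values -/

/-- The monic real quadratic polynomial whose zeros are the points of the unit circle with real
part `x`. -/
noncomputable def circleQuadratic (x : ℝ) : ℝ[X] := X ^ 2 - C (2 * x) * X + C 1

theorem momentForm_X_mul_circleQuadratic_mul (c : ℤ → ℝ) (x : ℝ) (p q : ℝ[X]) :
    momentForm c (X * p) (circleQuadratic x * q) =
      momentForm c p (X * q) - 2 * x * momentForm c p q + momentForm c (X * p) q := by
  have e : circleQuadratic x * q = X * (X * q) - C (2 * x) * (X * q) + q := by
    rw [circleQuadratic, C_1]; ring
  rw [e, map_add, map_sub, momentForm_C_mul_right, momentForm_X_mul_X_mul, momentForm_X_mul_X_mul]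

/-- Comparison of the zeros of two paraorthogonal polynomials with different moments. -/
theorem two_mul_sub_mul_momentForm {c d : ℤ → ℝ} (hc : ∀ j, c (-j) = c j)
    (hd : ∀ j, d (-j) = d j) {n : ℕ} {x y : ℝ} {p q : ℝ[X]} (hp : p.natDegree < n)
    (hq : q.natDegree < n) (hcp : realPopuc c n 1 = circleQuadratic x * p)
    (hdq : realPopuc d n 1 = circleQuadratic y * q) :
    2 * (x - y) * momentForm c q p =
      momentForm (fun j => c j - d j) (X * p) (circleQuadratic y * q) := by
  have h1 := momentForm_X_mul_realPopuc hc 1 hq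
  have h2 := momentForm_X_mul_realPopuc hd 1 hp
  rw [hcp, momentForm_X_mul_circleQuadratic_mul] at h1
  rw [hdq] at h2
  rw [momentForm_sub_weight, h2, momentForm_X_mul_circleQuadratic_mul,
    momentForm_comm hc p (X * q), momentForm_comm hc (X * p) q, momentForm_comm hc p q]
  linear_combination -h1

theorem exists_pos_momentForm_eq_mul {d : ℤ → ℝ} {k : ℤ} {n : ℕ} (hk : |k| ≤ (n : ℤ))
    (hdk : d (-k) = d k) (hd : ∀ j, j ≠ k → j ≠ -k → d j = 0) {p q : ℝ[X]}
    (hp : HasPosCoeffs p) (hpn : p.natDegree + 1 = n) (hq : HasPosCoeffs q)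
    (hqn : q.natDegree = n + 1) : ∃ a > 0, momentForm d (X * p) q = d k * a := by
  have hpX : (X * p).natDegree < n + 1 := by
    refine Nat.lt_succ_of_le (natDegree_mul_le.trans ?_)
    rw [natDegree_X]; omega
  have hpos : ∀ i, 0 ≤ (X * p).coeff i := by
    intro i
    cases i with
    | zero => simp
    | succ i => rw [coeff_X_mul]; exact hp.coeff_nonneg i
  have hposX : ∀ i, 1 ≤ i → i ≤ n → 0 < (X * p).coeff i := by
    intro i h1 h2
    obtain ⟨i, rfl⟩ := Nat.exists_eq_add_of_le' h1
    rw [coeff_X_mul]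
    exact hp i (by omega)
  -- A single indicator of the disjunction avoids double counting when k = 0.
  refine ⟨∑ i ∈ Finset.range (n + 1), ∑ l ∈ Finset.range (n + 2), (X * p).coeff i * q.coeff l *
    (if (i : ℤ) - l = k ∨ (i : ℤ) - l = -k then 1 else 0), ?_, ?_⟩
  · have hnn : ∀ i l : ℕ, 0 ≤ (X * p).coeff i * q.coeff l *
        (if (i : ℤ) - l = k ∨ (i : ℤ) - l = -k then 1 else 0) := fun i l =>
      mul_nonneg (mul_nonneg (hpos i) (hq.coeff_nonneg l)) (by split_ifs <;> norm_num)
    obtain ⟨i, l, hi, hi', hl, hil⟩ : ∃ i l : ℕ, 1 ≤ i ∧ i ≤ n ∧ l ≤ n + 1 ∧ (i : ℤ) - l = k := by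
      rw [abs_le] at hk
      -- X p has no constant term, so i must start at 1. The pairs (1, 1 - k) and (k, 0) fit the
      -- degrees exactly because |k| ≤ n.
      rcases le_or_gt k 0 with h | h
      · exact ⟨1, (1 - k).toNat, le_rfl, by omega, by omega, by omega⟩
      · exact ⟨k.toNat, 0, by omega, by omega, by omega, by omega⟩
    refine Finset.sum_pos' (fun i _ => Finset.sum_nonneg fun l _ => hnn i l)
      ⟨i, Finset.mem_range.2 (by omega), Finset.sum_pos' (fun l _ => hnn i l)
        ⟨l, Finset.mem_range.2 (by omega), ?_⟩⟩
    rw [if_pos (Or.inl hil), mul_one]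
    exact mul_pos (hposX i hi hi') (hq l (by omega))
  · rw [momentForm_eq_sum d hpX (M := n + 2) (by omega), Finset.mul_sum]
    refine Finset.sum_congr rfl fun i _ => ?_
    rw [Finset.mul_sum]
    refine Finset.sum_congr rfl fun l _ => ?_
    split_ifs with h
    · rcases h with h | h
      · rw [h]; ring
      · rw [h, hdk]; ring
    · rw [not_or] at h
      rw [hd _ h.1 h.2]; ring

/-- Division from the top: q_i = p_(i+2) + 2x q_(i+1) - q_(i+2), with q_i = 0 for i ≥ n. -/
theorem continuousOn_coeff_of_circleQuadratic_mul {I : Set ℝ} {p q : ℝ → ℝ[X]} {x : ℝ → ℝ} {n : ℕ}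
    (hp : ∀ i, ContinuousOn (fun t => (p t).coeff i) I) (hx : ContinuousOn x I)
    (hpq : ∀ t ∈ I, p t = circleQuadratic (x t) * q t) (hq : ∀ t ∈ I, (q t).natDegree < n)
    (i : ℕ) : ContinuousOn (fun t => (q t).coeff i) I := by
  have key : ∀ m i : ℕ, n ≤ i + m → ContinuousOn (fun t => (q t).coeff i) I := by
    intro m
    induction m with
    | zero =>
      intro i hi
      refine continuousOn_const.congr (f := fun _ => (0 : ℝ)) fun t ht => ?_
      exact coeff_eq_zero_of_natDegree_lt ((hq t ht).trans_le hi)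
    | succ m ih =>
      intro i hi
      refine (((hp (i + 2)).add ((continuousOn_const (c := (2 : ℝ))).mul
        (hx.mul (ih (i + 1) (by omega))))).sub
        (ih (i + 2) (by omega))).congr fun t ht => ?_
      have e : circleQuadratic (x t) * q t =
          X * (X * q t) - C (2 * x t) * (X * q t) + q t := by
        rw [circleQuadratic, C_1]; ring
      have := congrArg (fun r => r.coeff (i + 2)) (hpq t ht)
      simp only [e, coeff_add, coeff_sub, coeff_X_mul, coeff_C_mul] at this
      simp only [Pi.add_apply, Pi.sub_apply, Pi.mul_apply, this]
      ring
  exact key n i (by omega)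

/-- Splitting off a pair of conjugate zeros of a paraorthogonal Hurwitz polynomial. -/
theorem exists_realPopuc_eq_circleQuadratic_mul {c : ℤ → ℝ} (hc : ∀ j, c (-j) = c j)
    (hpos : ∀ m, (toeplitz (fun j => (c j : ℂ)) m).PosDef) {n : ℕ}
    (hH : IsHurwitz (popuc (fun j => (c j : ℂ)) n (-1))) {z : ℂ}
    (hz : (popuc (fun j => (c j : ℂ)) n (-1)).IsRoot z) (him : z.im ≠ 0) :
    ∃ q : ℝ[X], realPopuc c n 1 = circleQuadratic z.re * q ∧ HasPosCoeffs q ∧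
      q.natDegree + 1 = n := by
  have hdet := realToeplitzDet_ne_zero hpos n
  have hnorm := popuc_isRoot_norm hc hpos hz
  rw [popuc_ofReal] at hz hH
  have hz' : aeval z (realPopuc c n 1) = 0 := by
    rw [IsRoot.def, eval_map] at hz
    exact hz
  obtain ⟨q, hq⟩ := quadratic_dvd_of_aeval_eq_zero_im_ne_zero _ hz' him
  have hm := realPopuc_monic n hdet 1
  rw [hq] at hm
  have hqm : q.Monic := (quadratic_monic _ _).of_mul_monic_left hm
  refine ⟨q, ?_, hasPosCoeffs_of_isHurwitz hqm ?_, ?_⟩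
  · rw [hq, hnorm, one_pow, circleQuadratic]
  · intro w hw
    refine hH w ?_
    rw [IsRoot.def] at hw ⊢
    rw [hq, Polynomial.map_mul, eval_mul, hw, mul_zero]
  · have := realPopuc_natDegree n hdet 1
    rw [hq, (quadratic_monic _ _).natDegree_mul hqm, quadratic_natDegree] at this
    omega

open scoped Topology in
/-- If the moment `c_k` increases, then the real part of a nonreal zero increases. -/
theorem strictMonoOn_re_zero {n : ℕ} {k : ℤ} (hk : |k| ≤ (n : ℤ)) {ε : ℝ} (hε : 0 < ε)
    {c : ℝ → ℤ → ℝ} (hc : ∀ t ∈ Set.Ioo (-ε) ε, ∀ j, c t (-j) = c t j)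
    (hconst : ∀ j : ℤ, j ≠ k → j ≠ -k → ∀ t ∈ Set.Ioo (-ε) ε, c t j = c 0 j)
    (hsmooth : ∀ j, ContDiffOn ℝ 1 (fun t => c t j) (Set.Ioo (-ε) ε))
    (hpos : ∀ t ∈ Set.Ioo (-ε) ε, ∀ m, (toeplitz (fun j => (c t j : ℂ)) m).PosDef)
    (hH : ∀ t ∈ Set.Ioo (-ε) ε, IsHurwitz (popuc (fun j => (c t j : ℂ)) n (-1)))
    (hmono : StrictMonoOn (fun t => c t k) (Set.Ioo (-ε) ε)) {ζ : ℝ → ℂ}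
    (hζ : ContinuousOn ζ (Set.Ioo (-ε) ε))
    (hroot : ∀ t ∈ Set.Ioo (-ε) ε, (popuc (fun j => (c t j : ℂ)) n (-1)).IsRoot (ζ t))
    (him : ∀ t ∈ Set.Ioo (-ε) ε, (ζ t).im ≠ 0) :
    StrictMonoOn (fun t => (ζ t).re) (Set.Ioo (-ε) ε) := by
  set I := Set.Ioo (-ε) ε with hI
  have hx : ContinuousOn (fun t => (ζ t).re) I := Complex.continuous_re.comp_continuousOn hζ
  have h0I : (0 : ℝ) ∈ I := ⟨by linarith, hε⟩
  have hex : ∀ t, ∃ q : ℝ[X], t ∈ I → realPopuc (c t) n 1 = circleQuadratic (ζ t).re * q ∧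
      HasPosCoeffs q ∧ q.natDegree + 1 = n := by
    intro t
    by_cases ht : t ∈ I
    · obtain ⟨q, hq⟩ := exists_realPopuc_eq_circleQuadratic_mul (hc t ht) (hpos t ht) (hH t ht)
        (hroot t ht) (him t ht)
      exact ⟨q, fun _ => hq⟩
    · exact ⟨0, fun h => absurd h ht⟩
  choose q hq using hex
  have hqn : ∀ t ∈ I, (q t).natDegree < n := fun t ht => by
    have := (hq t ht).2.2
    omega
  have hPpos : ∀ t ∈ I, HasPosCoeffs (realPopuc (c t) n 1) := fun t ht =>
    hasPosCoeffs_of_isHurwitz (realPopuc_monic n (realToeplitzDet_ne_zero (hpos t ht) n) 1)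
      (by rw [← popuc_ofReal]; exact hH t ht)
  have hmain : ∀ s ∈ I, ∀ t ∈ I, ∃ a > 0,
      2 * ((ζ s).re - (ζ t).re) * momentForm (c s) (q t) (q s) = (c s k - c t k) * a := by
    intro s hs t ht
    rw [two_mul_sub_mul_momentForm (hc s hs) (hc t ht) (hqn s hs) (hqn t ht) (hq s hs).1
      (hq t ht).1, ← (hq t ht).1]
    refine exists_pos_momentForm_eq_mul hk ?_ ?_ (hq s hs).2.1 (hq s hs).2.2 (hPpos t ht)
      (realPopuc_natDegree n (realToeplitzDet_ne_zero (hpos t ht) n) 1)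
    · simp only [hc s hs, hc t ht]
    · intro j h1 h2
      rw [hconst j h1 h2 s hs, hconst j h1 h2 t ht, sub_self]
  have hinj : Set.InjOn (fun t => (ζ t).re) I := by
    intro s hs t ht hst
    obtain ⟨a, ha, e⟩ := hmain s hs t ht
    have hst' : (ζ s).re = (ζ t).re := hst
    rw [hst', sub_self, mul_zero, zero_mul] at e
    have : c s k = c t k := by
      rcases mul_eq_zero.1 e.symm with h | h
      · exact sub_eq_zero.1 h
      · exact absurd h ha.ne'
    exact hmono.injOn hs ht this
  refine (hx.strictMonoOn_of_injOn_Ioo (by linarith) hinj).resolve_right fun hanti => ?_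
  -- Injectivity leaves the sign open, since ⟨q_t, q_s⟩ is known to be positive only for s = t.
  -- Continuity extends this to s near 0, and one s > 0 there excludes a decreasing real part.
  have hqc : ∀ i, ContinuousOn (fun t => (q t).coeff i) I :=
    continuousOn_coeff_of_circleQuadratic_mul
      (fun i => (contDiffOn_realPopuc_coeff hsmooth hpos n i 1).continuousOn) hx
      (fun t ht => (hq t ht).1) hqn
  have hB : ContinuousOn (fun s => momentForm (c s) (q 0) (q s)) I := by
    refine ContinuousOn.congr (f := fun s => ∑ i ∈ Finset.range n, ∑ l ∈ Finset.range n,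
      (q 0).coeff i * (q s).coeff l * c s ((i : ℤ) - (l : ℤ))) ?_ fun s hs =>
        momentForm_eq_sum (c s) (hqn 0 h0I) (hqn s hs)
    exact continuousOn_finsetSum _ fun i _ => continuousOn_finsetSum _ fun l _ =>
      (continuousOn_const.mul (hqc l)).mul (hsmooth _).continuousOn
  have hB0 : 0 < momentForm (c 0) (q 0) (q 0) :=
    momentForm_self_pos (hc 0 h0I) (hpos 0 h0I) (hq 0 h0I).2.1.ne_zero
  have hnhds : I ∈ 𝓝 (0 : ℝ) := isOpen_Ioo.mem_nhds h0I
  have hev : ∀ᶠ s in 𝓝 (0 : ℝ), 0 < momentForm (c s) (q 0) (q s) ∧ s ∈ I :=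
    ((hB.continuousAt hnhds).eventually (lt_mem_nhds hB0)).and hnhds
  obtain ⟨s, ⟨hsB, hsI⟩, hs⟩ := ((hev.filter_mono nhdsWithin_le_nhds).and
    (self_mem_nhdsWithin : Set.Ioi (0 : ℝ) ∈ 𝓝[>] 0)).exists
  obtain ⟨a, ha, e⟩ := hmain s hsI 0 h0I
  have h1 : 0 < (c s k - c 0 k) * a := mul_pos (sub_pos.2 (hmono h0I hsI hs)) ha
  have h2 : (ζ s).re - (ζ 0).re < 0 := sub_neg.2 (hanti h0I hsI hs)
  rw [← e] at h1
  nlinarith [mul_pos (neg_pos.2 h2) hsB]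

/-! ### Position on the circle and the final assembly -/

theorem eq_neg_one_of_im_eq_zero {z : ℂ} (h1 : ‖z‖ = 1) (him : z.im = 0) (hre : z.re < 0) :
    z = -1 := by
  have e : z = (z.re : ℂ) := Complex.ext rfl (by simp [him])
  rw [e, Complex.norm_real, Real.norm_eq_abs, abs_of_neg hre] at h1
  rw [e, show z.re = -1 by linarith]
  simp

/-- A point of the unit circle with nonnegative imaginary part in polar form. -/
theorem eq_exp_arccos_re {z : ℂ} (h1 : ‖z‖ = 1) (him : 0 ≤ z.im) :
    z = Complex.exp (Real.arccos z.re * Complex.I) := by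
  have hsq : z.re * z.re + z.im * z.im = 1 := by
    rw [← Complex.normSq_apply, Complex.normSq_eq_norm_sq, h1, one_pow]
  rw [Complex.exp_mul_I, ← Complex.ofReal_cos, ← Complex.ofReal_sin,
    Real.cos_arccos (by nlinarith) (by nlinarith), Real.sin_arccos,
    show 1 - z.re ^ 2 = z.im ^ 2 by linarith, Real.sqrt_sq him, Complex.re_add_im]

theorem eq_exp_neg_arccos_re {z : ℂ} (h1 : ‖z‖ = 1) (him : z.im ≤ 0) :
    z = Complex.exp ((-Real.arccos z.re : ℝ) * Complex.I) := by
  have h := eq_exp_arccos_re (z := (starRingEnd ℂ) z) (by simpa using h1) (by simpa using him)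
  have h2 := congrArg (starRingEnd ℂ) h
  rw [Complex.conj_conj, ← Complex.exp_conj, map_mul, Complex.conj_ofReal, Complex.conj_I,
    Complex.conj_re] at h2
  rw [Complex.ofReal_neg, neg_mul, ← mul_neg]
  exact h2

-- The only real point available is -1, which is a zero for every t. By local uniqueness, a branch
-- that meets -1 stays there nearby, so the times at which it does form a set that is open and has
-- open complement in I. Connectedness then excludes it.
open scoped Topology in
theorem zeroBranch_im_ne_zero {J : Set ℝ} (hJ : IsOpen J) {c : ℝ → ℤ → ℝ}
    (hc : ∀ t ∈ J, ∀ j, c t (-j) = c t j) (hsmooth : ∀ j, ContDiffOn ℝ 1 (fun t => c t j) J)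
    (hpos : ∀ t ∈ J, ∀ m, (toeplitz (fun j => (c t j : ℂ)) m).PosDef) {n : ℕ}
    (hH : ∀ t ∈ J, IsHurwitz (popuc (fun j => (c t j : ℂ)) n (-1)))
    (hneg : ∀ t ∈ J, (popuc (fun j => (c t j : ℂ)) n (-1)).IsRoot (-1)) {I : Set ℝ}
    (hI : IsOpen I) (hIc : IsPreconnected I) (hIJ : I ⊆ J) (h0I : (0 : ℝ) ∈ I) {ζ : ℝ → ℂ}
    (hζ : ContinuousOn ζ I) (hroot : ∀ t ∈ I, (popuc (fun j => (c t j : ℂ)) n (-1)).IsRoot (ζ t))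
    (him : (ζ 0).im ≠ 0) : ∀ t ∈ I, (ζ t).im ≠ 0 := by
  have hsub : I ⊆ I ∩ ζ ⁻¹' {-1}ᶜ := by
    refine hIc.subset_left_of_subset_union (v := I ∩ ζ ⁻¹' {-1})
      (hζ.isOpen_inter_preimage hI isOpen_compl_singleton) ?_ ?_ ?_ ⟨0, h0I, h0I, ?_⟩
    · rw [isOpen_iff_mem_nhds]
      rintro t ⟨ht, htζ⟩
      obtain ⟨g, _, _, hev⟩ := exists_popuc_zero hJ hc hsmooth hpos (hIJ ht) (hneg t (hIJ ht))
      have hζt : Filter.Tendsto (fun s => (s, ζ s)) (𝓝 t) (𝓝 (t, -1)) := by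
        have := (hζ.continuousAt (hI.mem_nhds ht)).tendsto
        rw [show ζ t = -1 from htζ] at this
        exact Filter.Tendsto.prodMk_nhds Filter.tendsto_id this
      have hct : Filter.Tendsto (fun s : ℝ => (s, (-1 : ℂ))) (𝓝 t) (𝓝 (t, -1)) :=
        Filter.Tendsto.prodMk_nhds Filter.tendsto_id tendsto_const_nhds
      filter_upwards [hζt.eventually hev, hct.eventually hev, hI.mem_nhds ht] with s h1 h2 hs
      exact ⟨hs, (h1.1 (hroot s hs)).symm.trans (h2.1 (hneg s (hIJ hs)))⟩
    · exact Set.disjoint_left.2 fun t h1 h2 => h1.2 h2.2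
    · intro t ht
      by_cases h : ζ t = -1
      · exact Or.inr ⟨ht, h⟩
      · exact Or.inl ⟨ht, h⟩
    · intro h
      rw [show ζ 0 = -1 from h] at him
      simp at him
  intro t ht h
  have htJ := hIJ ht
  exact (hsub ht).2 (eq_neg_one_of_im_eq_zero
    (popuc_isRoot_norm (hc t htJ) (hpos t htJ) (hroot t ht)) h (hH t htJ _ (hroot t ht)))

theorem pos_of_isPreconnected {I : Set ℝ} (hIc : IsPreconnected I) {f : ℝ → ℝ}
    (hf : ContinuousOn f I) (hne : ∀ t ∈ I, f t ≠ 0) {t₀ : ℝ} (ht₀ : t₀ ∈ I) (h₀ : 0 < f t₀) :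
    ∀ t ∈ I, 0 < f t := by
  intro t ht
  by_contra h
  obtain ⟨s, hs, hs0⟩ := hIc.intermediate_value ht ht₀ hf ⟨not_lt.1 h, h₀.le⟩
  exact hne s hs hs0

theorem corollary2
    (n : ℕ) (k : ℤ) (hk : |k| ≤ (n : ℤ))
    -- the parameter interval
    (J : Set ℝ) (hJ_open : IsOpen J) (hJ_interval : J.OrdConnected) (hJ_zero : (0 : ℝ) ∈ J)
    -- the real sequence `c_j = c t j`, in which only `c_k = c_{-k}` depends on the parameter
    (c : ℝ → ℤ → ℝ)
    (hc_symm : ∀ t ∈ J, ∀ j : ℤ, c t (-j) = c t j)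
    (hc_const : ∀ j : ℤ, j ≠ k → j ≠ -k → ∀ t ∈ J, c t j = c 0 j)
    (hc_smooth : ContDiffOn ℝ 1 (fun t => c t k) J)
    (hc_pos : ∀ t ∈ J, ∀ m : ℕ, (toeplitz (fun j => (c t j : ℂ)) m).PosDef)
    (hc_hurwitz : ∀ t ∈ J, IsHurwitz (cdKernel (fun j => (c t j : ℂ)) n (-1)))
    (hc_mono : StrictMonoOn (fun t => c t k) J)
    (ζ₀ : ℂ) (hζ₀ : (popuc (fun j => (c 0 j : ℂ)) n (-1)).IsRoot ζ₀) :
    -- the zero `ζ(t)` with `ζ(0) = ζ₀` is well defined for small `t`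
    (∃ ε > (0 : ℝ), ∃ δ > (0 : ℝ), Set.Ioo (-ε) ε ⊆ J ∧ ∃ ζ : ℝ → ℂ,
      IsZeroBranch (fun t => popuc (fun j => (c t j : ℂ)) n (-1)) ζ₀ ε δ ζ ∧
      ∀ ζ' : ℝ → ℂ, IsZeroBranch (fun t => popuc (fun j => (c t j : ℂ)) n (-1)) ζ₀ ε δ ζ' →
        Set.EqOn ζ' ζ (Set.Ioo (-ε) ε)) ∧
    -- and it moves in the stated direction on every such interval
    (∀ ε > (0 : ℝ), ∀ δ > (0 : ℝ), Set.Ioo (-ε) ε ⊆ J → ∀ ζ : ℝ → ℂ,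
      IsZeroBranch (fun t => popuc (fun j => (c t j : ℂ)) n (-1)) ζ₀ ε δ ζ →
      (0 < ζ₀.im → MovesClockwiseAlong leftHalfCircle (Set.Ioo (-ε) ε) ζ) ∧
      (ζ₀.im < 0 → MovesCounterclockwiseAlong leftHalfCircle (Set.Ioo (-ε) ε) ζ)) := by
  have hsmooth : ∀ j, ContDiffOn ℝ 1 (fun t => c t j) J := by
    intro j
    by_cases h1 : j = k
    · rw [h1]; exact hc_smooth
    by_cases h2 : j = -k
    · rw [h2]
      exact hc_smooth.congr fun t ht => hc_symm t ht k
    · exact (contDiffOn_const (c := c 0 j)).congr fun t ht => hc_const j h1 h2 t ht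
  refine ⟨exists_unique_zeroBranch hJ_open hJ_zero hc_symm hsmooth hc_pos hζ₀, ?_⟩
  intro ε hε δ hδ hIJ ζ hζ
  have hH : ∀ t ∈ J, IsHurwitz (popuc (fun j => (c t j : ℂ)) n (-1)) := fun t ht =>
    isHurwitz_popuc (hc_symm t ht) (hc_pos t ht) (hc_hurwitz t ht)
  have hneg : ∀ t ∈ J, (popuc (fun j => (c t j : ℂ)) n (-1)).IsRoot (-1) := fun t ht =>
    popuc_isRoot_neg_one (hc_symm t ht) (hc_pos t ht) (hc_hurwitz t ht)
  have h0I : (0 : ℝ) ∈ Set.Ioo (-ε) ε := ⟨by linarith, hε⟩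
  have hcont : ContinuousOn ζ (Set.Ioo (-ε) ε) := hζ.differentiableOn.continuousOn
  have himc : ContinuousOn (fun t => (ζ t).im) (Set.Ioo (-ε) ε) :=
    Complex.continuous_im.comp_continuousOn hcont
  have hnorm : ∀ t ∈ Set.Ioo (-ε) ε, ‖ζ t‖ = 1 := fun t ht =>
    mem_sphere_zero_iff_norm.1 (hζ.mapsTo ht).2
  have hleft : Set.MapsTo ζ (Set.Ioo (-ε) ε) leftHalfCircle := fun t ht =>
    ⟨(hζ.mapsTo ht).2, hH t (hIJ ht) _ (hζ.isRoot t ht)⟩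
  have hne : ζ₀.im ≠ 0 → ∀ t ∈ Set.Ioo (-ε) ε, (ζ t).im ≠ 0 := fun h =>
    zeroBranch_im_ne_zero hJ_open hc_symm hsmooth hc_pos hH hneg isOpen_Ioo isPreconnected_Ioo hIJ
      h0I hcont hζ.isRoot (by rwa [hζ.map_zero])
  have hre : ζ₀.im ≠ 0 → StrictMonoOn (fun t => (ζ t).re) (Set.Ioo (-ε) ε) := fun h =>
    strictMonoOn_re_zero hk hε (fun t ht => hc_symm t (hIJ ht))
      (fun j h1 h2 t ht => hc_const j h1 h2 t (hIJ ht)) (fun j => (hsmooth j).mono hIJ)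
      (fun t ht => hc_pos t (hIJ ht)) (fun t ht => hH t (hIJ ht)) (hc_mono.mono hIJ) hcont
      hζ.isRoot (hne h)
  have hrange : ∀ t ∈ Set.Ioo (-ε) ε, (ζ t).re ∈ Set.Icc (-1 : ℝ) 1 := fun t ht =>
    abs_le.1 ((Complex.abs_re_le_norm _).trans (hnorm t ht).le)
  have hacos : ContinuousOn (fun t => Real.arccos (ζ t).re) (Set.Ioo (-ε) ε) :=
    Real.continuous_arccos.comp_continuousOn (Complex.continuous_re.comp_continuousOn hcont)
  have hanti : ζ₀.im ≠ 0 → StrictAntiOn (fun t => Real.arccos (ζ t).re) (Set.Ioo (-ε) ε) :=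
    fun h s hs t ht hst => Real.strictAntiOn_arccos (hrange s hs) (hrange t ht) (hre h hs ht hst)
  -- The imaginary part keeps its sign, so the argument is arccos of the real part above the axis
  -- and its negative below.
  refine ⟨fun him => ⟨hleft, fun t => Real.arccos (ζ t).re, hacos, fun t ht => ?_,
    hanti him.ne'⟩, fun him => ⟨hleft, fun t => -Real.arccos (ζ t).re, hacos.neg, fun t ht => ?_,
    (hanti him.ne).neg⟩⟩
  · exact eq_exp_arccos_re (hnorm t ht) (pos_of_isPreconnected isPreconnected_Ioo himc
      (hne him.ne') h0I (by rwa [hζ.map_zero]) t ht).le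
  · refine eq_exp_neg_arccos_re (hnorm t ht) ?_
    have := pos_of_isPreconnected isPreconnected_Ioo himc.neg
      (fun t ht => neg_ne_zero.2 (hne him.ne t ht)) h0I
      (by simpa only [Pi.neg_apply, hζ.map_zero] using neg_pos.2 him) t ht
    exact (neg_pos.1 this).le
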